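/- Let $d\in\{1,2\}$ and let $S_d^+$ be the cone of symmetric positive semi-definite real $d\times d$ matrices. Let $p\ge 0$ and let $\omega,\sigma\in S_d^+$ with $\sigma$ invertible; if $d=1$, assume in addition that $(p,\omega)\neq(0,0)$. Then the following are equivalent. 1. There exists a Borel probability measure $\Gamma(p,\omega;\sigma)$ on $S_d^+$, different from the point mass at $0$, whose Laplace transform is $$\int_{S_d^+} e^{-\operatorname{tr}(u\xi)}\,\Gamma(p,\omega;\sigma)(d\xi)=\bigl(\det(I+\sigma u)\bigr)^{-p}\,e^{-\operatorname{tr}\left(u(I+\sigma u)^{-1}\omega\right)}\qquad\text{for all }u\in S_d^+ .$$ 2. $p\in\Lambda_d$, where $\Lambda_d=\{\tfrac j2 : j=1,2,\dots,d-2\}\cup[\tfrac{d-1}{2},\infty)$ is the Gindikin ensemble; that is, $\Lambda_1=[0,\infty)$ and $\Lambda_2=[\tfrac12,\infty)$. -/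

import Mathlib

open MeasureTheory

noncomputable section

/-- The cone `S_d^+` of symmetric positive semi-definite real `d × d` matrices, with the topology
and the Borel `σ`-algebra inherited from the space of matrices. -/
abbrev PSDCone (d : ℕ) : Type :=
  {A : Matrix (Fin d) (Fin d) ℝ // A.PosSemidef}

instance PSDCone.instZero (d : ℕ) : Zero (PSDCone d) :=
  ⟨⟨0, Matrix.PosSemidef.zero⟩⟩

instance PSDCone.instMeasurableSpace (d : ℕ) : MeasurableSpace (PSDCone d) :=
  borel (PSDCone d)

instance PSDCone.instBorelSpace (d : ℕ) : BorelSpace (PSDCone d) :=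
  ⟨rfl⟩

/-- The Laplace transform of a measure on the cone, with respect to the pairing `tr (u ξ)`. The
integrand takes values in `(0, 1]` for `u` in the cone, so it is integrable for finite `μ`. -/
def laplaceTransform {d : ℕ} (μ : Measure (PSDCone d)) (u : PSDCone d) : ℝ :=
  ∫ ξ, Real.exp (-(u.1 * ξ.1).trace) ∂μ

/-- The function `u ↦ det(I + σ u)^{-p} exp(-tr(u (I + σ u)⁻¹ ω))`. -/
def wishartLaplace {d : ℕ} (p : ℝ) (ω σ : PSDCone d) (u : PSDCone d) : ℝ :=
  (1 + σ.1 * u.1).det ^ (-p) * Real.exp (-(u.1 * (1 + σ.1 * u.1)⁻¹ * ω.1).trace)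

/-- `μ` is the non-central Wishart distribution `Γ(p, ω; σ)`. -/
structure IsNoncentralWishart {d : ℕ} (p : ℝ) (ω σ : PSDCone d)
    (μ : Measure (PSDCone d)) : Prop where
  isProbabilityMeasure : IsProbabilityMeasure μ
  laplaceTransform_eq : ∀ u : PSDCone d, laplaceTransform μ u = wishartLaplace p ω σ u

/-- The Gindikin ensemble `Λ_d = {j/2 : j = 1, …, d - 2} ∪ [(d - 1)/2, ∞)`. -/
def gindikinEnsemble (d : ℕ) : Set ℝ :=
  {x | ∃ j : ℕ, 1 ≤ j ∧ j + 2 ≤ d ∧ x = (j : ℝ) / 2} ∪ Set.Ici (((d : ℝ) - 1) / 2)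

theorem gindikinEnsemble_one : gindikinEnsemble 1 = Set.Ici 0 := by
  ext x
  simp [gindikinEnsemble]

theorem gindikinEnsemble_two : gindikinEnsemble 2 = Set.Ici (1 / 2) := by
  ext x
  simp only [gindikinEnsemble, Set.mem_union, Set.mem_ofPred_eq, Set.mem_Ici]
  constructor
  · rintro (⟨j, h1, h2, -⟩ | h)
    · omega
    · norm_num at h ⊢
      exact h
  · intro h
    right
    norm_num at h ⊢
    exact h

end

/-!
Congruence by a square root of `σ` reduces everything to `σ = 1`.

In dimension one the distribution is a Poisson mixture of gamma laws. For existence in dimension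
two, start from the Wishart process driven by noise in a single coordinate direction: along the rank
one matrix `σ₂ = diag (0, 1)` it is an explicit kernel, a Gaussian shift of the off-diagonal part
together with a non-central gamma law of shape `p - 1/2` for the Schur complement. Since
`u ↦ u (1 + σ u)⁻¹` is the time one flow of a Riccati equation, these flows compose additively in
`σ`, and so do the kernels; composing the ones for the two coordinate directions produces
`σ = diag (1, 0) + diag (0, 1) = 1`.

For necessity in dimension two, write the cone as the forward light cone. There
`cosh x + cosh y ≤ 1 + cosh z` whenever `x ^ 2 + y ^ 2 ≤ z ^ 2`, and integrating this bound against
the distribution compares values of the Laplace transform at `(t, ±s, 0)`, `(t, 0, ±s)` with values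
on the axis. At second order in `s → 0` the comparison reads `p + τ / T ≤ 2 (p + τ / (2 T)) ^ 2` for
`τ = tr ω` and all `T > 1`, and `T → ∞` gives `p ≤ 2 p ^ 2`. So `p ≥ 1/2` or `p = 0`; in the latter
case `T = 1 + τ` gives `τ = 0`, and the distribution is the point mass at `0`.
-/

open ProbabilityTheory Filter
open scoped NNReal ENNReal Topology

theorem lintegral_exp_neg_gammaMeasure {q a : ℝ} (hq : 0 < q) (ha : 0 ≤ a) :
    ∫⁻ x, ENNReal.ofReal (Real.exp (-(a * x))) ∂gammaMeasure q 1 =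
      ENNReal.ofReal ((1 + a) ^ (-q)) := by
  have ha' : 0 < 1 + a := by linarith
  have hpdf : Measurable (gammaPDF q 1) := (measurable_gammaPDFReal q 1).ennreal_ofReal
  have htilt (x : ℝ) : gammaPDF q 1 x * ENNReal.ofReal (Real.exp (-(a * x))) =
      ENNReal.ofReal ((1 + a) ^ (-q)) * gammaPDF q (1 + a) x := by
    rcases lt_or_ge x 0 with hx | hx
    · rw [gammaPDF_of_neg hx, gammaPDF_of_neg hx, zero_mul, mul_zero]
    · rw [gammaPDF_of_nonneg hx, gammaPDF_of_nonneg hx, ← ENNReal.ofReal_mul (by positivity),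
        ← ENNReal.ofReal_mul (by positivity), Real.one_rpow, Real.rpow_neg ha'.le,
        show -((1 + a) * x) = -(1 * x) + -(a * x) by ring, Real.exp_add]
      congr 1
      field_simp
  calc ∫⁻ x, ENNReal.ofReal (Real.exp (-(a * x))) ∂gammaMeasure q 1
      = ∫⁻ x, gammaPDF q 1 x * ENNReal.ofReal (Real.exp (-(a * x))) :=
        lintegral_withDensity_eq_lintegral_mul _ hpdf (by fun_prop)
    _ = ENNReal.ofReal ((1 + a) ^ (-q)) * ∫⁻ x, gammaPDF q (1 + a) x := by
        simp_rw [htilt, lintegral_const_mul' _ _ ENNReal.ofReal_ne_top]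
    _ = ENNReal.ofReal ((1 + a) ^ (-q)) := by
        rw [lintegral_gammaPDF_eq_one hq ha', mul_one]

/-- The gamma law on the half-line with shape `q ≥ 0` and rate `1`, including its weak limit, the
point mass at `0`, for `q = 0`. -/
noncomputable def gammaLaw (q : ℝ) : Measure ℝ≥0 :=
  if q = 0 then Measure.dirac 0 else (gammaMeasure q 1).map Real.toNNReal

theorem lintegral_exp_neg_gammaLaw {q a : ℝ} (hq : 0 ≤ q) (ha : 0 ≤ a) :
    ∫⁻ x, ENNReal.ofReal (Real.exp (-(a * x))) ∂gammaLaw q = ENNReal.ofReal ((1 + a) ^ (-q)) := by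
  rcases hq.eq_or_lt with rfl | hq
  · simp [gammaLaw]
  · have hnonneg : ∀ᵐ x ∂gammaMeasure q 1, 0 ≤ x := by
      have hpdf : Measurable (gammaPDF q 1) := (measurable_gammaPDFReal q 1).ennreal_ofReal
      rw [gammaMeasure, ae_withDensity_iff hpdf]
      exact ae_of_all _ fun x hx => not_lt.mp fun hneg => hx (gammaPDF_of_neg hneg)
    rw [gammaLaw, if_neg hq.ne', lintegral_map (by fun_prop) (by fun_prop),
      ← lintegral_exp_neg_gammaMeasure hq ha]
    refine lintegral_congr_ae ?_
    filter_upwards [hnonneg] with x hx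
    rw [Real.coe_toNNReal x hx]

theorem lintegral_pow_poissonMeasure (w : ℝ≥0) {z : ℝ} (hz : 0 ≤ z) :
    ∫⁻ k, ENNReal.ofReal (z ^ k) ∂poissonMeasure w = ENNReal.ofReal (Real.exp (w * (z - 1))) := by
  have hsum : HasSum (fun k : ℕ => Real.exp (-w) * ((w * z) ^ k / k.factorial))
      (Real.exp (-w) * Real.exp (w * z)) := by
    rw [Real.exp_eq_exp_ℝ]
    exact (NormedSpace.expSeries_div_hasSum_exp (w * z)).mul_left _
  rw [lintegral_countable', mul_sub_one, sub_eq_neg_add, Real.exp_add, ← hsum.tsum_eq,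
    ENNReal.ofReal_tsum_of_nonneg (fun k => by positivity) hsum.summable]
  refine tsum_congr fun k => ?_
  rw [poissonMeasure_singleton, ← ENNReal.ofReal_mul (by positivity), mul_pow]
  ring_nf

/-- The Poisson law as a Markov kernel in its mean. -/
noncomputable def poissonLawKernel : Kernel ℝ≥0 ℕ where
  toFun := poissonMeasure
  measurable' := by
    refine Measure.measurable_of_measurable_coe _ fun s hs => ?_
    simp only [poissonMeasure, Measure.sum_apply _ hs, Measure.smul_apply, smul_eq_mul]
    exact Measurable.tsum fun k => by fun_prop

/-- The non-central gamma law with shape `p` and non-centrality `w`, as a kernel in `w`: the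
mixture of the laws `gammaLaw (p + k)` over a Poisson variable `k` with mean `w`. -/
noncomputable def noncentralGamma (p : ℝ) : Kernel ℝ≥0 ℝ≥0 :=
  Kernel.ofFunOfCountable (fun k : ℕ => gammaLaw (p + k)) ∘ₖ poissonLawKernel

theorem lintegral_exp_neg_noncentralGamma {p a : ℝ} (w : ℝ≥0) (hp : 0 ≤ p) (ha : 0 ≤ a) :
    ∫⁻ x, ENNReal.ofReal (Real.exp (-(a * x))) ∂noncentralGamma p w =
      ENNReal.ofReal ((1 + a) ^ (-p) * Real.exp (-(a * w / (1 + a)))) := by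
  have ha' : 0 < 1 + a := by linarith
  have hcond (k : ℕ) : ∫⁻ x, ENNReal.ofReal (Real.exp (-(a * x))) ∂gammaLaw (p + k) =
      ENNReal.ofReal ((1 + a) ^ (-p)) * ENNReal.ofReal ((1 + a)⁻¹ ^ k) := by
    rw [lintegral_exp_neg_gammaLaw (by positivity) ha, ← ENNReal.ofReal_mul (by positivity),
      neg_add, Real.rpow_add ha', Real.rpow_neg ha'.le (k : ℝ), Real.rpow_natCast, inv_pow]
  calc ∫⁻ x, ENNReal.ofReal (Real.exp (-(a * x))) ∂noncentralGamma p w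
      = ∫⁻ k, ∫⁻ x, ENNReal.ofReal (Real.exp (-(a * x))) ∂gammaLaw (p + k) ∂poissonMeasure w :=
        Kernel.lintegral_comp _ _ _ (by fun_prop)
    _ = ENNReal.ofReal ((1 + a) ^ (-p)) *
          ENNReal.ofReal (Real.exp (w * ((1 + a)⁻¹ - 1))) := by
        simp_rw [hcond, lintegral_const_mul' _ _ ENNReal.ofReal_ne_top]
        rw [lintegral_pow_poissonMeasure w (by positivity)]
    _ = ENNReal.ofReal ((1 + a) ^ (-p) * Real.exp (-(a * w / (1 + a)))) := by
        rw [← ENNReal.ofReal_mul (by positivity)]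
        congr 3
        field_simp
        ring

theorem isMarkovKernel_noncentralGamma {p : ℝ} (hp : 0 ≤ p) :
    IsMarkovKernel (noncentralGamma p) :=
  ⟨fun w => ⟨by simpa using lintegral_exp_neg_noncentralGamma w hp le_rfl⟩⟩

-- Completing the square: the tilted density is a multiple of that of `N((m - 2 b v) / D, v / D)`.
theorem gaussianPDF_mul_exp_neg_quadratic (m b x : ℝ) {a : ℝ} {v D : ℝ≥0} (hv : v ≠ 0)
    (hD : (D : ℝ) = 1 + 2 * a * v) (hDpos : 0 < (D : ℝ)) :
    gaussianPDF m v x * ENNReal.ofReal (Real.exp (-(a * x ^ 2 + 2 * b * x))) =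
      ENNReal.ofReal ((D : ℝ) ^ (-(1 / 2) : ℝ) *
        Real.exp ((2 * b ^ 2 * v - 2 * b * m - a * m ^ 2) / D)) *
        gaussianPDF ((m - 2 * b * v) / D) (v / D) x := by
  have hsqrt : (√(2 * Real.pi * (v / D)))⁻¹ = (√(2 * Real.pi * v))⁻¹ * (D : ℝ) ^ (1 / 2 : ℝ) := by
    rw [← mul_div_assoc, Real.sqrt_div (by positivity), inv_div, Real.sqrt_eq_rpow D]
    ring
  have hexp : Real.exp (-(x - m) ^ 2 / (2 * v)) * Real.exp (-(a * x ^ 2 + 2 * b * x)) =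
      Real.exp ((2 * b ^ 2 * v - 2 * b * m - a * m ^ 2) / D) *
        Real.exp (-(x - (m - 2 * b * v) / D) ^ 2 / (2 * (v / D))) := by
    rw [← Real.exp_add, ← Real.exp_add]
    congr 1
    field_simp
    rw [hD]
    ring
  have hne : (D : ℝ) ^ (1 / 2 : ℝ) ≠ 0 := (Real.rpow_pos_of_pos hDpos _).ne'
  rw [gaussianPDF, gaussianPDF, ← ENNReal.ofReal_mul (gaussianPDFReal_nonneg _ _ _),
    ← ENNReal.ofReal_mul (by positivity), gaussianPDFReal, gaussianPDFReal, NNReal.coe_div,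
    hsqrt, Real.rpow_neg hDpos.le, mul_assoc, hexp]
  field_simp

theorem lintegral_exp_neg_quadratic_gaussianReal (m : ℝ) (v : ℝ≥0) {a : ℝ} (ha : 0 ≤ a) (b : ℝ) :
    ∫⁻ x, ENNReal.ofReal (Real.exp (-(a * x ^ 2 + 2 * b * x))) ∂gaussianReal m v =
      ENNReal.ofReal ((1 + 2 * a * v) ^ (-(1 / 2) : ℝ) *
        Real.exp ((2 * b ^ 2 * v - 2 * b * m - a * m ^ 2) / (1 + 2 * a * v))) := by
  rcases eq_or_ne v 0 with rfl | hv
  · simp only [gaussianReal_zero_var, lintegral_dirac, NNReal.coe_zero, mul_zero, add_zero,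
      Real.one_rpow, one_mul, div_one, zero_sub]
    ring_nf
  obtain ⟨D, hD⟩ : ∃ D : ℝ≥0, (D : ℝ) = 1 + 2 * a * v := ⟨⟨1 + 2 * a * v, by positivity⟩, rfl⟩
  have hDpos : 0 < (D : ℝ) := by rw [hD]; positivity
  rw [← hD]
  calc ∫⁻ x, ENNReal.ofReal (Real.exp (-(a * x ^ 2 + 2 * b * x))) ∂gaussianReal m v
      = ∫⁻ x, gaussianPDF m v x * ENNReal.ofReal (Real.exp (-(a * x ^ 2 + 2 * b * x))) := by
        rw [gaussianReal_of_var_ne_zero m hv]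
        exact lintegral_withDensity_eq_lintegral_mul _ (by fun_prop) (by fun_prop)
    _ = ENNReal.ofReal ((D : ℝ) ^ (-(1 / 2) : ℝ) *
          Real.exp ((2 * b ^ 2 * v - 2 * b * m - a * m ^ 2) / D)) := by
        simp_rw [gaussianPDF_mul_exp_neg_quadratic m b _ hv hD hDpos,
          lintegral_const_mul' _ _ ENNReal.ofReal_ne_top]
        rw [lintegral_gaussianPDF_eq_one _ (div_ne_zero hv (NNReal.coe_pos.mp hDpos).ne'), mul_one]

namespace PSDCone

variable {d : ℕ}

/-- The identity matrix as a point of the cone. -/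
instance instOne : One (PSDCone d) :=
  ⟨⟨1, Matrix.PosSemidef.one⟩⟩

/-- The monoid of `d × d` matrices, and with it the general linear group, acts on the cone by
congruences `g • ξ = g ξ gᵀ`. -/
instance instMulAction : MulAction (Matrix (Fin d) (Fin d) ℝ) (PSDCone d) where
  smul g ξ := ⟨g * ξ.1 * g.transpose, ξ.2.mul_mul_conjTranspose_same g⟩
  one_smul ξ := Subtype.ext (by
    change 1 * ξ.1 * Matrix.transpose 1 = ξ.1
    rw [Matrix.transpose_one, one_mul, mul_one])
  mul_smul g h ξ := Subtype.ext (by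
    change g * h * ξ.1 * (g * h).transpose = g * (h * ξ.1 * h.transpose) * g.transpose
    simp only [Matrix.transpose_mul, Matrix.mul_assoc])

theorem coe_zero : (0 : PSDCone d).1 = 0 := rfl

theorem coe_one : (1 : PSDCone d).1 = 1 := rfl

theorem coe_smul (g : Matrix (Fin d) (Fin d) ℝ) (ξ : PSDCone d) :
    (g • ξ).1 = g * ξ.1 * g.transpose := rfl

instance instSMulZeroClass : SMulZeroClass (Matrix (Fin d) (Fin d) ℝ) (PSDCone d) where
  smul_zero g := Subtype.ext (by rw [coe_smul, coe_zero, mul_zero, zero_mul])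

instance instContinuousConstSMul :
    ContinuousConstSMul (Matrix (Fin d) (Fin d) ℝ) (PSDCone d) where
  continuous_const_smul g := by
    refine continuous_induced_rng.mpr ?_
    change Continuous fun ξ : PSDCone d => g * ξ.1 * g.transpose
    fun_prop

open scoped MatrixOrder Matrix.Norms.L2Operator in
theorem exists_smul_one_eq {σ : PSDCone d} (hσ : IsUnit σ.1) :
    ∃ g : GL (Fin d) ℝ, g • 1 = σ := by
  obtain ⟨B, hB⟩ := CStarAlgebra.nonneg_iff_eq_star_mul_self.mp σ.2.nonneg
  have hBunit : IsUnit B.transpose := by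
    rw [hB, Matrix.isUnit_iff_isUnit_det, Matrix.det_mul] at hσ
    rw [Matrix.isUnit_iff_isUnit_det, Matrix.det_transpose]
    exact isUnit_of_mul_isUnit_right hσ
  obtain ⟨g, hg⟩ := hBunit
  refine ⟨g, Subtype.ext ?_⟩
  rw [Units.smul_def, coe_smul, coe_one, hg, mul_one, Matrix.transpose_transpose, hB,
    Matrix.star_eq_conjTranspose, Matrix.conjTranspose_eq_transpose_of_trivial]

open scoped MatrixOrder Matrix.Norms.L2Operator in
theorem det_one_add_mul_pos (σ u : PSDCone d) : 0 < (1 + σ.1 * u.1).det := by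
  obtain ⟨B, hB⟩ := CStarAlgebra.nonneg_iff_eq_star_mul_self.mp u.2.nonneg
  rw [hB, ← mul_assoc, Matrix.det_one_add_mul_comm, ← mul_assoc]
  exact (Matrix.PosDef.one.add_posSemidef (σ.2.mul_mul_conjTranspose_same B)).det_pos

theorem isUnit_det_one_add_mul (σ u : PSDCone d) : IsUnit (1 + σ.1 * u.1).det :=
  (det_one_add_mul_pos σ u).ne'.isUnit

/-- `riccati σ u = u (1 + σ u)⁻¹` is the value at time `1` of the solution of the matrix Riccati
equation `ψ' = -ψ σ ψ` with `ψ 0 = u`. -/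
noncomputable def riccati (σ u : PSDCone d) : PSDCone d :=
  ⟨u.1 * (1 + σ.1 * u.1)⁻¹, by
    set A := (1 + σ.1 * u.1)⁻¹ with hA
    have hleft : A.transpose * (1 + u.1 * σ.1) = 1 := by
      have := congrArg Matrix.transpose (Matrix.mul_nonsing_inv _ (isUnit_det_one_add_mul σ u))
      rwa [Matrix.transpose_mul, Matrix.transpose_add, Matrix.transpose_mul, ← hA,
        Matrix.transpose_one, show σ.1.transpose = σ.1 from σ.2.1,
        show u.1.transpose = u.1 from u.2.1] at this
    have hsymm : u.1 * A = A.transpose * (u.1 + u.1 * σ.1 * u.1) * A := by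
      calc u.1 * A = A.transpose * (1 + u.1 * σ.1) * u.1 * A := by rw [hleft, one_mul]
        _ = A.transpose * (u.1 + u.1 * σ.1 * u.1) * A := by
          rw [mul_assoc A.transpose, add_mul, one_mul]
    rw [hsymm]
    have huσu : (u.1 * σ.1 * u.1).PosSemidef := by
      have := σ.2.mul_mul_conjTranspose_same u.1
      rwa [u.2.1] at this
    exact (u.2.add huσu).conjTranspose_mul_mul_same A⟩

theorem coe_riccati (σ u : PSDCone d) : (riccati σ u).1 = u.1 * (1 + σ.1 * u.1)⁻¹ := rfl

variable {σ₁ σ₂ σ : PSDCone d}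

theorem one_add_mul_riccati (hσ : σ.1 = σ₁.1 + σ₂.1) (u : PSDCone d) :
    1 + σ₁.1 * (riccati σ₂ u).1 = (1 + σ.1 * u.1) * (1 + σ₂.1 * u.1)⁻¹ := by
  calc 1 + σ₁.1 * (riccati σ₂ u).1
      = (1 + σ₂.1 * u.1) * (1 + σ₂.1 * u.1)⁻¹ + σ₁.1 * u.1 * (1 + σ₂.1 * u.1)⁻¹ := by
        rw [Matrix.mul_nonsing_inv _ (isUnit_det_one_add_mul σ₂ u), coe_riccati, mul_assoc]
    _ = (1 + σ.1 * u.1) * (1 + σ₂.1 * u.1)⁻¹ := by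
        rw [hσ, ← add_mul, add_mul σ₁.1]
        congr 1
        abel

theorem det_one_add_mul_riccati (hσ : σ.1 = σ₁.1 + σ₂.1) (u : PSDCone d) :
    (1 + σ₂.1 * u.1).det * (1 + σ₁.1 * (riccati σ₂ u).1).det = (1 + σ.1 * u.1).det := by
  rw [one_add_mul_riccati hσ, Matrix.det_mul, mul_comm, mul_assoc, ← Matrix.det_mul,
    Matrix.nonsing_inv_mul _ (isUnit_det_one_add_mul σ₂ u), Matrix.det_one, mul_one]

theorem riccati_riccati (hσ : σ.1 = σ₁.1 + σ₂.1) (u : PSDCone d) :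
    riccati σ₁ (riccati σ₂ u) = riccati σ u := by
  refine Subtype.ext ?_
  rw [coe_riccati, one_add_mul_riccati hσ, coe_riccati, coe_riccati, Matrix.mul_inv_rev,
    Matrix.nonsing_inv_nonsing_inv _ (isUnit_det_one_add_mul σ₂ u), mul_assoc, ← mul_assoc _⁻¹,
    Matrix.nonsing_inv_mul _ (isUnit_det_one_add_mul σ₂ u), one_mul]

/-- The multiple `t • 1` of the identity matrix as a point of the cone. -/
def scalar (t : ℝ≥0) : PSDCone d :=
  ⟨(t : ℝ) • 1, Matrix.PosSemidef.one.smul t.2⟩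

end PSDCone

section wishartLaplace

variable {d : ℕ} {p : ℝ} {ω σ σ₁ σ₂ : PSDCone d}

theorem wishartLaplace_pos (p : ℝ) (ω σ u : PSDCone d) : 0 < wishartLaplace p ω σ u :=
  mul_pos (Real.rpow_pos_of_pos (PSDCone.det_one_add_mul_pos σ u) _) (Real.exp_pos _)

theorem wishartLaplace_eq_riccati (p : ℝ) (ω σ u : PSDCone d) :
    wishartLaplace p ω σ u =
      (1 + σ.1 * u.1).det ^ (-p) * Real.exp (-((PSDCone.riccati σ u).1 * ω.1).trace) := rfl

theorem wishartLaplace_smul (g : GL (Fin d) ℝ) (p : ℝ) (ω σ u : PSDCone d) :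
    wishartLaplace p (g • ω) (g • σ) u = wishartLaplace p ω σ (g.1.transpose • u) := by
  obtain ⟨B, C, hBC, hCB⟩ := g
  simp only [wishartLaplace, Units.smul_def, PSDCone.coe_smul, Matrix.transpose_transpose]
  set M := 1 + σ.1 * (B.transpose * u.1 * B) with hM
  have hconj : 1 + B * σ.1 * B.transpose * u.1 = B * M * C := by
    calc 1 + B * σ.1 * B.transpose * u.1
        = B * C + B * σ.1 * B.transpose * u.1 * (B * C) := by rw [hBC, mul_one]
      _ = B * M * C := by
        rw [hM]
        simp only [mul_add, add_mul, mul_assoc, mul_one]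
  have hdet : (B * M * C).det = M.det := by
    rw [Matrix.det_mul_right_comm, hBC, one_mul]
  have hinv : (B * M * C)⁻¹ = B * M⁻¹ * C := by
    rw [Matrix.mul_inv_rev, Matrix.mul_inv_rev, Matrix.inv_eq_left_inv hCB,
      Matrix.inv_eq_left_inv hBC, mul_assoc]
  have htrace : (u.1 * (B * M⁻¹ * C) * (B * ω.1 * B.transpose)).trace =
      (B.transpose * u.1 * B * M⁻¹ * ω.1).trace := by
    calc (u.1 * (B * M⁻¹ * C) * (B * ω.1 * B.transpose)).trace
        = (u.1 * B * M⁻¹ * (C * B) * ω.1 * B.transpose).trace := by simp only [mul_assoc]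
      _ = (B.transpose * u.1 * B * M⁻¹ * ω.1).trace := by
        rw [hCB, mul_one, Matrix.trace_mul_comm]
        simp only [mul_assoc]
  rw [hconj, hdet, hinv, htrace]

theorem wishartLaplace_one_scalar (p : ℝ) (ω : PSDCone d) (t : ℝ≥0) :
    wishartLaplace p ω 1 (PSDCone.scalar t) =
      (1 + t : ℝ) ^ (-(d * p)) * Real.exp (-(t / (1 + t) * ω.1.trace)) := by
  have ht : (0 : ℝ) < 1 + t := by positivity
  have hadd : 1 + (1 : PSDCone d).1 * (PSDCone.scalar t : PSDCone d).1 = (1 + t : ℝ) • 1 := by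
    rw [PSDCone.coe_one, one_mul, PSDCone.scalar, add_smul, one_smul]
  have hinv : ((1 + t : ℝ) • (1 : Matrix (Fin d) (Fin d) ℝ))⁻¹ = (1 + t : ℝ)⁻¹ • 1 :=
    Matrix.inv_eq_left_inv (by rw [smul_mul_smul_comm, inv_mul_cancel₀ ht.ne', one_smul, one_mul])
  have htrace : ((PSDCone.scalar t : PSDCone d).1 * (1 + t : ℝ)⁻¹ • 1 * ω.1).trace =
      t / (1 + t) * ω.1.trace := by
    rw [PSDCone.scalar, smul_mul_smul_comm, one_mul, smul_one_mul, Matrix.trace_smul, smul_eq_mul,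
      div_eq_mul_inv]
  rw [wishartLaplace, hadd, hinv, htrace, Matrix.det_smul, Matrix.det_one, mul_one,
    Fintype.card_fin, ← Real.rpow_natCast_mul ht.le, mul_neg]

theorem wishartLaplace_riccati (hσ : σ.1 = σ₁.1 + σ₂.1) (p : ℝ) (ω u : PSDCone d) :
    (1 + σ₂.1 * u.1).det ^ (-p) * wishartLaplace p ω σ₁ (PSDCone.riccati σ₂ u) =
      wishartLaplace p ω σ u := by
  rw [wishartLaplace_eq_riccati, wishartLaplace_eq_riccati, PSDCone.riccati_riccati hσ, ← mul_assoc,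
    ← Real.mul_rpow (PSDCone.det_one_add_mul_pos σ₂ u).le (PSDCone.det_one_add_mul_pos σ₁ _).le,
    PSDCone.det_one_add_mul_riccati hσ]

end wishartLaplace

section IsNoncentralWishart

variable {d : ℕ} {p : ℝ} {ω σ σ₁ σ₂ : PSDCone d} {μ : Measure (PSDCone d)}

theorem measurable_ofReal_exp_neg_trace (u : PSDCone d) :
    Measurable fun ξ : PSDCone d => ENNReal.ofReal (Real.exp (-(u.1 * ξ.1).trace)) := by
  have hcont : Continuous fun ξ : PSDCone d => Real.exp (-(u.1 * ξ.1).trace) := by fun_prop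
  exact hcont.measurable.ennreal_ofReal

theorem IsNoncentralWishart.integrable (h : IsNoncentralWishart p ω σ μ) (u : PSDCone d) :
    Integrable (fun ξ : PSDCone d => Real.exp (-(u.1 * ξ.1).trace)) μ :=
  .of_integral_ne_zero ((h.laplaceTransform_eq u).trans_ne (wishartLaplace_pos p ω σ u).ne')

theorem isNoncentralWishart_iff_lintegral :
    IsNoncentralWishart p ω σ μ ↔
      ∀ u : PSDCone d, ∫⁻ ξ, ENNReal.ofReal (Real.exp (-(u.1 * ξ.1).trace)) ∂μ =
        ENNReal.ofReal (wishartLaplace p ω σ u) := by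
  refine ⟨fun h u => ?_, fun h => ⟨⟨?_⟩, fun u => ?_⟩⟩
  · rw [← h.laplaceTransform_eq, laplaceTransform,
      ofReal_integral_eq_lintegral_ofReal (h.integrable u) (ae_of_all _ fun ξ => Real.exp_nonneg _)]
  · simpa [wishartLaplace, PSDCone.coe_zero] using h 0
  · have hcont : Continuous fun ξ : PSDCone d => Real.exp (-(u.1 * ξ.1).trace) := by fun_prop
    rw [laplaceTransform, integral_eq_lintegral_of_nonneg_ae
      (ae_of_all _ fun ξ => Real.exp_nonneg _) hcont.aestronglyMeasurable, h u,
      ENNReal.toReal_ofReal (wishartLaplace_pos p ω σ u).le]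

theorem IsNoncentralWishart.map_smul (h : IsNoncentralWishart p ω σ μ) (g : GL (Fin d) ℝ) :
    IsNoncentralWishart p (g • ω) (g • σ) (μ.map (g • ·)) := by
  rw [isNoncentralWishart_iff_lintegral] at h ⊢
  intro u
  rw [wishartLaplace_smul, ← h,
    lintegral_map (measurable_ofReal_exp_neg_trace u) (measurable_const_smul g)]
  refine lintegral_congr fun ξ => ?_
  rw [Units.smul_def, PSDCone.coe_smul, PSDCone.coe_smul, Matrix.transpose_transpose,
    ← mul_assoc, Matrix.trace_mul_comm]
  simp only [mul_assoc]

theorem exists_isNoncentralWishart_smul_iff (g : GL (Fin d) ℝ) :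
    (∃ μ, IsNoncentralWishart p (g • ω) (g • σ) μ ∧ μ ≠ Measure.dirac 0) ↔
      ∃ μ, IsNoncentralWishart p ω σ μ ∧ μ ≠ Measure.dirac 0 := by
  have hmap (g : GL (Fin d) ℝ) {ω σ : PSDCone d} :
      (∃ μ, IsNoncentralWishart p ω σ μ ∧ μ ≠ Measure.dirac 0) →
        ∃ μ, IsNoncentralWishart p (g • ω) (g • σ) μ ∧ μ ≠ Measure.dirac 0 := by
    rintro ⟨μ, hμ, hne⟩
    have hdirac : (Measure.dirac (0 : PSDCone d)).map (g • ·) = Measure.dirac 0 := by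
      rw [Measure.map_dirac' (measurable_const_smul g), smul_zero]
    exact ⟨_, hμ.map_smul g, fun h => hne <|
      (MeasurableEquiv.smul g).map_measurableEquiv_injective (h.trans hdirac.symm)⟩
  refine ⟨fun h => ?_, hmap g⟩
  simpa only [inv_smul_smul] using hmap g⁻¹ h

theorem IsNoncentralWishart.bind {κ : Kernel (PSDCone d) (PSDCone d)}
    (h : IsNoncentralWishart p ω σ₁ μ) (hκ : ∀ η, IsNoncentralWishart p η σ₂ (κ η))
    (hσ : σ.1 = σ₁.1 + σ₂.1) : IsNoncentralWishart p ω σ (μ.bind κ) := by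
  rw [isNoncentralWishart_iff_lintegral] at h ⊢
  intro u
  have hcond (η : PSDCone d) : ∫⁻ ξ, ENNReal.ofReal (Real.exp (-(u.1 * ξ.1).trace)) ∂κ η =
      ENNReal.ofReal ((1 + σ₂.1 * u.1).det ^ (-p)) *
        ENNReal.ofReal (Real.exp (-((PSDCone.riccati σ₂ u).1 * η.1).trace)) := by
    rw [isNoncentralWishart_iff_lintegral.mp (hκ η), wishartLaplace_eq_riccati,
      ENNReal.ofReal_mul (Real.rpow_nonneg (PSDCone.det_one_add_mul_pos σ₂ u).le _)]
  rw [Measure.lintegral_bind κ.aemeasurable (measurable_ofReal_exp_neg_trace u).aemeasurable]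
  simp_rw [hcond, lintegral_const_mul' _ _ ENNReal.ofReal_ne_top]
  rw [h, ← ENNReal.ofReal_mul (Real.rpow_nonneg (PSDCone.det_one_add_mul_pos σ₂ u).le _),
    wishartLaplace_riccati hσ]

theorem laplaceTransform_scalar_le_one [IsProbabilityMeasure μ] (t : ℝ≥0) :
    laplaceTransform μ (PSDCone.scalar t) ≤ 1 := by
  have hle (ξ : PSDCone d) : Real.exp (-((PSDCone.scalar t : PSDCone d).1 * ξ.1).trace) ≤ 1 := by
    rw [Real.exp_le_one_iff, PSDCone.scalar, smul_one_mul, Matrix.trace_smul]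
    exact neg_nonpos.mpr (smul_nonneg t.2 ξ.2.trace_nonneg)
  calc laplaceTransform μ (PSDCone.scalar t) ≤ ∫ _, 1 ∂μ :=
        integral_mono_of_nonneg (ae_of_all _ fun ξ => Real.exp_nonneg _) (integrable_const 1)
          (ae_of_all _ hle)
    _ = 1 := by simp

theorem IsNoncentralWishart.nonneg (hd : 1 ≤ d) (h : IsNoncentralWishart p ω 1 μ) : 0 ≤ p := by
  have := h.isProbabilityMeasure
  by_contra! hp
  have hdp : 0 < -(d * p) := by
    have : (0 : ℝ) < d := by exact_mod_cast hd
    nlinarith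
  have hbound (t : ℝ≥0) : (1 + t : ℝ) ^ (-(d * p)) ≤ Real.exp ω.1.trace := by
    have hle := laplaceTransform_scalar_le_one (μ := μ) t
    rw [h.laplaceTransform_eq, wishartLaplace_one_scalar, Real.exp_neg, ← div_eq_mul_inv,
      div_le_one (Real.exp_pos _)] at hle
    refine hle.trans (Real.exp_le_exp.mpr (mul_le_of_le_one_left ω.2.trace_nonneg ?_))
    exact (div_le_one (by positivity)).mpr (by linarith)
  have htendsto : Tendsto (fun t : ℝ≥0 => (1 + t : ℝ) ^ (-(d * p))) atTop atTop :=
    (tendsto_rpow_atTop hdp).comp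
      (tendsto_atTop_add_const_left _ _ (NNReal.tendsto_coe_atTop.mpr tendsto_id))
  obtain ⟨t, ht⟩ := (htendsto.eventually_gt_atTop (Real.exp ω.1.trace)).exists
  exact (hbound t).not_gt ht

theorem IsNoncentralWishart.eq_dirac_zero (h : IsNoncentralWishart 0 0 σ μ) :
    μ = Measure.dirac 0 := by
  have := h.isProbabilityMeasure
  have hint := h.integrable 1
  have hlap : ∫ ξ : PSDCone d, Real.exp (-((1 : PSDCone d).1 * ξ.1).trace) ∂μ = 1 := by
    simpa [laplaceTransform, wishartLaplace, PSDCone.coe_zero] using h.laplaceTransform_eq 1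
  simp only [PSDCone.coe_one, one_mul] at hint hlap
  have hzero : ∫ ξ : PSDCone d, (1 - Real.exp (-ξ.1.trace)) ∂μ = 0 := by
    rw [integral_sub (integrable_const _) hint, hlap]
    simp
  rw [integral_eq_zero_iff_of_nonneg (fun ξ => sub_nonneg.mpr
    (Real.exp_le_one_iff.mpr (neg_nonpos.mpr ξ.2.trace_nonneg)))
    ((integrable_const _).sub hint)] at hzero
  have hid : (id : PSDCone d → PSDCone d) =ᵐ[μ] fun _ => 0 := by
    filter_upwards [hzero] with ξ hξ
    rw [Pi.zero_apply, sub_eq_zero, eq_comm, Real.exp_eq_one_iff, neg_eq_zero] at hξ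
    exact Subtype.ext (ξ.2.trace_eq_zero_iff.mp hξ)
  rw [← Measure.map_id (μ := μ), Measure.map_congr hid, Measure.map_const, measure_univ, one_smul]

theorem IsNoncentralWishart.ne_dirac_zero (hd : 1 ≤ d) (hp : 0 ≤ p)
    (h : IsNoncentralWishart p ω 1 μ) (hpω : p = 0 → ω ≠ 0) : μ ≠ Measure.dirac 0 := by
  rintro rfl
  have hcont : Continuous fun ξ : PSDCone d =>
    Real.exp (-((PSDCone.scalar 1 : PSDCone d).1 * ξ.1).trace) := by fun_prop
  have hlap := h.laplaceTransform_eq (PSDCone.scalar 1)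
  rw [laplaceTransform, integral_dirac' _ _ hcont.stronglyMeasurable, wishartLaplace_one_scalar,
    PSDCone.coe_zero, mul_zero, Matrix.trace_zero, neg_zero, Real.exp_zero, NNReal.coe_one] at hlap
  have htrace := ω.2.trace_nonneg
  have hexp : Real.exp (-(1 / (1 + 1) * ω.1.trace)) ≤ 1 :=
    Real.exp_le_one_iff.mpr (by linarith)
  rcases hp.eq_or_lt with rfl | hp
  · rw [mul_zero, neg_zero, Real.rpow_zero, one_mul, eq_comm, Real.exp_eq_one_iff] at hlap
    exact hpω rfl (Subtype.ext (ω.2.trace_eq_zero_iff.mp (by linarith)))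
  · have : (0 : ℝ) < d := by exact_mod_cast hd
    have hrpow : (1 + 1 : ℝ) ^ (-(d * p)) < 1 :=
      Real.rpow_lt_one_of_one_lt_of_neg (by norm_num) (neg_lt_zero.mpr (by positivity))
    exact hlap.not_gt (mul_lt_one_of_nonneg_of_lt_one_left (by positivity) hrpow hexp)

end IsNoncentralWishart

section Existence

variable {p : ℝ}

theorem PSDCone.measurable_scalar {d : ℕ} :
    Measurable (PSDCone.scalar : ℝ≥0 → PSDCone d) := by
  refine Continuous.measurable (continuous_induced_rng.mpr ?_)
  change Continuous fun t : ℝ≥0 => (t : ℝ) • (1 : Matrix (Fin d) (Fin d) ℝ)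
  fun_prop

theorem PSDCone.exists_scalar_eq (ω : PSDCone 1) : ∃ w, PSDCone.scalar w = ω := by
  refine ⟨⟨ω.1 0 0, ω.2.diag_nonneg⟩, Subtype.ext ?_⟩
  ext i j
  fin_cases i
  fin_cases j
  exact mul_one (ω.1 0 0)

theorem isNoncentralWishart_map_scalar_noncentralGamma (hp : 0 ≤ p) (w : ℝ≥0) :
    IsNoncentralWishart p (PSDCone.scalar w : PSDCone 1) 1
      ((noncentralGamma p w).map PSDCone.scalar) := by
  rw [isNoncentralWishart_iff_lintegral]
  intro u
  obtain ⟨t, rfl⟩ := u.exists_scalar_eq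
  have htrace : (PSDCone.scalar w : PSDCone 1).1.trace = w := by
    simp [PSDCone.scalar]
  rw [lintegral_map (measurable_ofReal_exp_neg_trace _) PSDCone.measurable_scalar,
    wishartLaplace_one_scalar, htrace, Nat.cast_one, one_mul, div_mul_eq_mul_div,
    ← lintegral_exp_neg_noncentralGamma w hp t.coe_nonneg]
  refine lintegral_congr fun x => ?_
  simp [PSDCone.scalar, mul_comm]

theorem posSemidef_fin_two_of_sq_le_mul {a b c : ℝ} (ha : 0 ≤ a) (hc : 0 ≤ c)
    (hb : b ^ 2 ≤ a * c) : Matrix.PosSemidef !![a, b; b, c] := by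
  refine .of_dotProduct_mulVec_nonneg ?_ fun v => ?_
  · ext i j; fin_cases i <;> fin_cases j <;> rfl
  · have hform : star v ⬝ᵥ !![a, b; b, c].mulVec v =
        a * v 0 ^ 2 + 2 * b * (v 0 * v 1) + c * v 1 ^ 2 := by
      simp [dotProduct, Matrix.mulVec, Fin.sum_univ_two]
      ring
    have hcross : (b * (v 0 * v 1)) ^ 2 ≤ (a * v 0 ^ 2) * (c * v 1 ^ 2) := by
      nlinarith [mul_le_mul_of_nonneg_right hb (sq_nonneg (v 0 * v 1))]
    have hsum : 0 ≤ a * v 0 ^ 2 + c * v 1 ^ 2 := by positivity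
    have habs := abs_le_of_sq_le_sq' (a := 2 * (b * (v 0 * v 1))) (by
      nlinarith [sq_nonneg (a * v 0 ^ 2 - c * v 1 ^ 2)]) hsum
    rw [hform]
    linarith [habs.1]

theorem PSDCone.coe_eq_fin_two (u : PSDCone 2) :
    u.1 = !![u.1 0 0, u.1 0 1; u.1 0 1, u.1 1 1] := by
  have hsymm : u.1 1 0 = u.1 0 1 := u.2.1.apply 0 1
  conv_lhs => rw [Matrix.eta_fin_two u.1, hsymm]

theorem PSDCone.sq_le_mul_fin_two (u : PSDCone 2) : u.1 0 1 ^ 2 ≤ u.1 0 0 * u.1 1 1 := by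
  have hdet := u.2.det_nonneg
  rw [u.coe_eq_fin_two, Matrix.det_fin_two_of] at hdet
  linarith

theorem PSDCone.trace_mul_fin_two (u ξ : PSDCone 2) :
    (u.1 * ξ.1).trace = u.1 0 0 * ξ.1 0 0 + 2 * u.1 0 1 * ξ.1 0 1 + u.1 1 1 * ξ.1 1 1 := by
  conv_lhs => rw [u.coe_eq_fin_two, ξ.coe_eq_fin_two, Matrix.mul_fin_two, Matrix.trace_fin_two_of]
  ring

/-- The positive semidefinite matrix whose first column is `r • (r, g)` and whose second diagonal
entry exceeds `g ^ 2` by `s`, where `v = (s, g, r)`. When `r ≠ 0`, `s` is the Schur complement of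
the first diagonal entry. -/
def PSDCone.ofSchur (v : ℝ≥0 × ℝ × ℝ) : PSDCone 2 :=
  ⟨!![v.2.2 ^ 2, v.2.2 * v.2.1; v.2.2 * v.2.1, v.1 + v.2.1 ^ 2],
    posSemidef_fin_two_of_sq_le_mul (by positivity) (by positivity) (by
      nlinarith [mul_nonneg (sq_nonneg v.2.2) v.1.2])⟩

/-- A right inverse of `PSDCone.ofSchur`. When the first diagonal entry vanishes, so does the
off-diagonal one, and the quotient takes the correct value `0`. -/
noncomputable def PSDCone.schur (ω : PSDCone 2) : ℝ≥0 × ℝ × ℝ :=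
  ((ω.1 1 1 - (ω.1 0 1 / √(ω.1 0 0)) ^ 2).toNNReal, ω.1 0 1 / √(ω.1 0 0), √(ω.1 0 0))

theorem PSDCone.measurable_ofSchur : Measurable PSDCone.ofSchur := by
  refine Continuous.measurable (continuous_induced_rng.mpr ?_)
  change Continuous fun v : ℝ≥0 × ℝ × ℝ =>
    !![v.2.2 ^ 2, v.2.2 * v.2.1; v.2.2 * v.2.1, v.1 + v.2.1 ^ 2]
  fun_prop

theorem PSDCone.measurable_schur : Measurable PSDCone.schur := by
  have hentry (i j : Fin 2) : Measurable fun ω : PSDCone 2 => ω.1 i j :=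
    (continuous_subtype_val.matrix_elem i j).measurable
  have hquot := (hentry 0 1).div (hentry 0 0).sqrt
  exact ((hentry 1 1).sub (hquot.pow_const 2)).real_toNNReal.prodMk
    (hquot.prodMk (hentry 0 0).sqrt)

theorem PSDCone.ofSchur_schur (ω : PSDCone 2) : PSDCone.ofSchur ω.schur = ω := by
  have h00 : 0 ≤ ω.1 0 0 := ω.2.diag_nonneg
  have hdet := ω.sq_le_mul_fin_two
  have hy : √(ω.1 0 0) * (ω.1 0 1 / √(ω.1 0 0)) = ω.1 0 1 := by
    rcases h00.eq_or_lt with h0 | h0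
    · rw [← h0, zero_mul] at hdet
      rw [pow_eq_zero_iff two_ne_zero |>.mp (hdet.antisymm (sq_nonneg _)), zero_div, mul_zero]
    · exact mul_div_cancel₀ _ (Real.sqrt_pos.mpr h0).ne'
  have hz : (ω.1 0 1 / √(ω.1 0 0)) ^ 2 ≤ ω.1 1 1 := by
    rw [div_pow, Real.sq_sqrt h00]
    exact div_le_of_le_mul₀ h00 ω.2.diag_nonneg (by linarith)
  refine Subtype.ext ?_
  rw [ω.coe_eq_fin_two]
  simp only [PSDCone.ofSchur, PSDCone.schur, Real.sq_sqrt h00, hy,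
    Real.coe_toNNReal _ (sub_nonneg.mpr hz), sub_add_cancel]

theorem wishartLaplace_ofSchur_fin_two (p : ℝ) (ω u : PSDCone 2) :
    wishartLaplace p ω (PSDCone.ofSchur (1, 0, 0)) u = (1 + u.1 1 1) ^ (-p) *
      Real.exp (-(u.1 0 0 * ω.1 0 0) + (u.1 0 1 ^ 2 * ω.1 0 0 - 2 * u.1 0 1 * ω.1 0 1 -
        u.1 1 1 * ω.1 1 1) / (1 + u.1 1 1)) := by
  have hc : 0 < 1 + u.1 1 1 := add_pos_of_pos_of_nonneg one_pos u.2.diag_nonneg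
  have hadd : 1 + (PSDCone.ofSchur (1, 0, 0)).1 * u.1 = !![1, 0; u.1 0 1, 1 + u.1 1 1] := by
    conv_lhs => rw [u.coe_eq_fin_two]
    simp [PSDCone.ofSchur, Matrix.one_fin_two]
  have hdet : (!![1, 0; u.1 0 1, 1 + u.1 1 1] : Matrix (Fin 2) (Fin 2) ℝ).det = 1 + u.1 1 1 := by
    rw [Matrix.det_fin_two_of, one_mul, zero_mul, sub_zero]
  have hriccati : (PSDCone.riccati (PSDCone.ofSchur (1, 0, 0)) u).1 = (1 + u.1 1 1)⁻¹ •
      !![u.1 0 0 * (1 + u.1 1 1) - u.1 0 1 ^ 2, u.1 0 1; u.1 0 1, u.1 1 1] := by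
    rw [PSDCone.coe_riccati, hadd, Matrix.inv_def, hdet, Ring.inverse_eq_inv', mul_smul_comm,
      Matrix.adjugate_fin_two_of]
    congr 1
    conv_lhs => lhs; rw [u.coe_eq_fin_two]
    rw [Matrix.mul_fin_two]
    ring_nf
  have htrace := PSDCone.trace_mul_fin_two (PSDCone.riccati (PSDCone.ofSchur (1, 0, 0)) u) ω
  rw [wishartLaplace_eq_riccati, htrace, hriccati, hadd, hdet]
  congr 2
  simp only [Matrix.smul_apply, Matrix.of_apply, Matrix.cons_val', Matrix.cons_val_zero,
    Matrix.cons_val_one, Matrix.cons_val_fin_one, smul_eq_mul]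
  field_simp
  ring

/-- The heat kernel `k ↦ 𝒩(k, v)` on the line. -/
noncomputable def gaussianKernel (v : ℝ≥0) : Kernel ℝ ℝ :=
  ⟨fun k => gaussianReal k v, by fun_prop⟩

theorem gaussianKernel_apply (v : ℝ≥0) (k : ℝ) : gaussianKernel v k = gaussianReal k v := rfl

instance instIsMarkovKernelGaussianKernel (v : ℝ≥0) : IsMarkovKernel (gaussianKernel v) :=
  ⟨fun k => inferInstanceAs (IsProbabilityMeasure (gaussianReal k v))⟩

/-- The transition kernel of the Wishart process of shape `p` driven by noise in the second
coordinate direction only: in the coordinates of `PSDCone.ofSchur` it adds a Gaussian variable to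
`g`, replaces `s` by an independent non-central gamma variable and leaves `r` unchanged. -/
noncomputable def schurKernel (p : ℝ) : Kernel (PSDCone 2) (PSDCone 2) :=
  ((noncentralGamma (p - 1 / 2) ∥ₖ (gaussianKernel (1 / 2) ∥ₖ Kernel.id)).comap
    PSDCone.schur PSDCone.measurable_schur).map PSDCone.ofSchur

theorem lintegral_schurKernel (hp : 1 / 2 ≤ p) (ω : PSDCone 2) {f : PSDCone 2 → ℝ≥0∞}
    (hf : Measurable f) :
    ∫⁻ ξ, f ξ ∂schurKernel p ω =
      ∫⁻ s, ∫⁻ g, f (PSDCone.ofSchur (s, g, ω.schur.2.2)) ∂gaussianReal ω.schur.2.1 (1 / 2)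
        ∂noncentralGamma (p - 1 / 2) ω.schur.1 := by
  have := isMarkovKernel_noncentralGamma (sub_nonneg.mpr hp)
  have hmeas : Measurable fun v => f (PSDCone.ofSchur v) := hf.comp PSDCone.measurable_ofSchur
  have hmeas₂ (s : ℝ≥0) : Measurable fun v : ℝ × ℝ => f (PSDCone.ofSchur (s, v)) :=
    hmeas.comp measurable_prodMk_left
  rw [schurKernel, Kernel.lintegral_map _ PSDCone.measurable_ofSchur _ hf, Kernel.lintegral_comap,
    Kernel.lintegral_parallelComp _ hmeas]
  refine lintegral_congr fun s => ?_
  rw [Kernel.lintegral_parallelComp _ (hmeas₂ s), gaussianKernel_apply]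
  exact lintegral_congr fun g => Kernel.lintegral_id _

theorem isNoncentralWishart_schurKernel (hp : 1 / 2 ≤ p) (ω : PSDCone 2) :
    IsNoncentralWishart p ω (PSDCone.ofSchur (1, 0, 0)) (schurKernel p ω) := by
  rw [isNoncentralWishart_iff_lintegral]
  intro u
  have hc : 0 ≤ u.1 1 1 := u.2.diag_nonneg
  have hfactor (s : ℝ≥0) (g r : ℝ) :
      ENNReal.ofReal (Real.exp (-(u.1 * (PSDCone.ofSchur (s, g, r)).1).trace)) =
        ENNReal.ofReal (Real.exp (-(u.1 0 0 * r ^ 2))) *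
          (ENNReal.ofReal (Real.exp (-(u.1 1 1 * s))) *
            ENNReal.ofReal (Real.exp (-(u.1 1 1 * g ^ 2 + 2 * (u.1 0 1 * r) * g)))) := by
    rw [← ENNReal.ofReal_mul (Real.exp_nonneg _), ← ENNReal.ofReal_mul (Real.exp_nonneg _),
      ← Real.exp_add, ← Real.exp_add, PSDCone.trace_mul_fin_two]
    congr 2
    simp only [PSDCone.ofSchur, Matrix.of_apply, Matrix.cons_val', Matrix.cons_val_zero,
      Matrix.cons_val_one, Matrix.cons_val_fin_one]
    ring
  rw [lintegral_schurKernel hp ω (measurable_ofReal_exp_neg_trace u)]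
  simp_rw [hfactor, lintegral_const_mul' _ _ ENNReal.ofReal_ne_top,
    lintegral_exp_neg_quadratic_gaussianReal _ _ hc]
  rw [lintegral_mul_const _ (by fun_prop),
    lintegral_exp_neg_noncentralGamma _ (sub_nonneg.mpr hp) hc, wishartLaplace_ofSchur_fin_two,
    ← ENNReal.ofReal_mul (by positivity), ← ENNReal.ofReal_mul (by positivity)]
  have hx : ω.schur.2.2 ^ 2 = ω.1 0 0 :=
    congrArg (fun ξ : PSDCone 2 => ξ.1 0 0) ω.ofSchur_schur
  have hy : ω.schur.2.2 * ω.schur.2.1 = ω.1 0 1 :=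
    congrArg (fun ξ : PSDCone 2 => ξ.1 0 1) ω.ofSchur_schur
  have hz : ω.schur.1 + ω.schur.2.1 ^ 2 = ω.1 1 1 :=
    congrArg (fun ξ : PSDCone 2 => ξ.1 1 1) ω.ofSchur_schur
  rw [← hx, ← hy, ← hz, show -p = -(p - 1 / 2) + -(1 / 2) by ring, Real.rpow_add (by positivity),
    show 1 + 2 * u.1 1 1 * ((1 / 2 : ℝ≥0) : ℝ) = 1 + u.1 1 1 by push_cast; ring,
    mul_mul_mul_comm, mul_left_comm, ← Real.exp_add, ← Real.exp_add]
  congr 3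
  push_cast
  field_simp
  ring

theorem exists_isNoncentralWishart_one_fin_two (hp : 1 / 2 ≤ p) (ω : PSDCone 2) :
    ∃ μ, IsNoncentralWishart p ω 1 μ := by
  let g : GL (Fin 2) ℝ := Matrix.GeneralLinearGroup.mkOfDetNeZero !![0, 1; 1, 0] (by simp)
  have hswap := (isNoncentralWishart_schurKernel hp (g⁻¹ • ω)).map_smul g
  rw [smul_inv_smul] at hswap
  refine ⟨_, hswap.bind (isNoncentralWishart_schurKernel hp) ?_⟩
  rw [Units.smul_def, PSDCone.coe_smul, PSDCone.coe_one]
  have hg : g.1 = !![0, 1; 1, 0] := rfl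
  have htranspose : (!![0, 1; 1, 0] : Matrix (Fin 2) (Fin 2) ℝ).transpose = !![0, 1; 1, 0] := by
    ext i j; fin_cases i <;> fin_cases j <;> rfl
  rw [hg, htranspose]
  simp [PSDCone.ofSchur, Matrix.one_fin_two]

end Existence

theorem cosh_add_cosh_le {x y z : ℝ} (h : x ^ 2 + y ^ 2 ≤ z ^ 2) :
    Real.cosh x + Real.cosh y ≤ 1 + Real.cosh z := by
  have hterm (n : ℕ) : x ^ (2 * n) / (2 * n).factorial + y ^ (2 * n) / (2 * n).factorial ≤
      (if n = 0 then 1 else 0) + z ^ (2 * n) / (2 * n).factorial := by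
    split_ifs with hn
    · simp [hn]
    · rw [zero_add, ← add_div, pow_mul, pow_mul, pow_mul]
      gcongr
      exact (pow_add_pow_le (sq_nonneg x) (sq_nonneg y) hn).trans (by gcongr)
  exact hasSum_le hterm ((Real.hasSum_cosh x).add (Real.hasSum_cosh y))
    ((hasSum_ite_eq 0 1).add (Real.hasSum_cosh z))

theorem le_sq_of_eventually_comp_sq_le_sq {f g : ℝ → ℝ} {f' g' : ℝ} (hf : HasDerivAt f f' 0)
    (hg : HasDerivAt g g' 0) (hf0 : f 0 = 0) (hg0 : g 0 = 0)
    (hfg : ∀ᶠ r in 𝓝[>] 0, f (r ^ 2) ≤ g r ^ 2) : f' ≤ g' ^ 2 := by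
  have hsq : Tendsto (fun r : ℝ => r ^ 2) (𝓝[>] 0) (𝓝[≠] 0) := by
    refine tendsto_nhdsWithin_iff.mpr ⟨?_, ?_⟩
    · exact ((continuous_pow 2).tendsto' 0 0 (by norm_num)).mono_left nhdsWithin_le_nhds
    · filter_upwards [self_mem_nhdsWithin] with r hr using (pow_pos hr 2).ne'
  have hf_lim := hf.tendsto_slope_zero.comp hsq
  have hg_lim := (hg.tendsto_slope_zero_right).pow 2
  refine le_of_tendsto_of_tendsto hf_lim hg_lim ?_
  filter_upwards [hfg] with r hr
  rw [Function.comp_apply, zero_add, zero_add, hf0, hg0, sub_zero, sub_zero, smul_eq_mul,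
    smul_eq_mul, mul_pow, inv_pow]
  exact mul_le_mul_of_nonneg_left hr (by positivity)

theorem hasDerivAt_add_sub_sub {f : ℝ → ℝ} {f' x : ℝ} (hf : HasDerivAt f f' x) :
    HasDerivAt (fun s => f (x + s) - f (x - s)) (2 * f') 0 := by
  have hadd : HasDerivAt (fun s => f (x + s)) f' 0 :=
    HasDerivAt.comp_const_add x 0 (by rwa [add_zero])
  have hsub : HasDerivAt (fun s => f (x - s)) (-f') 0 :=
    HasDerivAt.comp_const_sub x 0 (by rwa [sub_zero])
  exact (hadd.sub hsub).congr_deriv (by ring)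

/-- The Laplace transform at `y - 1` of the non-central gamma distribution with shape `p` and
non-centrality `c`, up to the constant factor `exp (-c)`. -/
noncomputable def gammaLaplace (p c y : ℝ) : ℝ :=
  y ^ (-p) * Real.exp (c / y)

section gammaLaplace

variable {p c x y : ℝ}

theorem gammaLaplace_pos (hy : 0 < y) : 0 < gammaLaplace p c y :=
  mul_pos (Real.rpow_pos_of_pos hy _) (Real.exp_pos _)

theorem gammaLaplace_mul_gammaLaplace (hx : 0 < x) (hy : 0 < y) :
    gammaLaplace p c x * gammaLaplace p c y = gammaLaplace p (c * (x + y)) (x * y) := by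
  rw [gammaLaplace, gammaLaplace, gammaLaplace, mul_mul_mul_comm, ← Real.mul_rpow hx.le hy.le,
    ← Real.exp_add]
  congr 2
  rw [div_add_div _ _ hx.ne' hy.ne', mul_comm x, mul_add, add_comm]

theorem two_mul_gammaLaplace_le (hy : 0 < y) (e : ℝ) :
    2 * gammaLaplace p c y ≤ gammaLaplace p (c - e) y + gammaLaplace p (c + e) y := by
  have hcosh : gammaLaplace p (c - e) y + gammaLaplace p (c + e) y =
      2 * gammaLaplace p c y * Real.cosh (e / y) := by
    simp only [gammaLaplace, add_div, neg_div, sub_eq_add_neg, Real.exp_add, Real.cosh_eq]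
    ring
  rw [hcosh]
  exact le_mul_of_one_le_right (by have := gammaLaplace_pos (p := p) (c := c) hy; positivity)
    (Real.one_le_cosh _)

theorem hasDerivAt_gammaLaplace (hy : 0 < y) :
    HasDerivAt (gammaLaplace p c) (-(p / y + c / y ^ 2) * gammaLaplace p c y) y := by
  have hrpow : HasDerivAt (fun y : ℝ => y ^ (-p)) (-p * y ^ (-p - 1)) y :=
    Real.hasDerivAt_rpow_const (Or.inl hy.ne')
  have hexp : HasDerivAt (fun y : ℝ => Real.exp (c / y))
      (Real.exp (c / y) * (c * -(y ^ 2)⁻¹)) y :=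
    ((hasDerivAt_inv hy.ne').const_mul c).exp
  refine (hrpow.mul hexp).congr_deriv ?_
  rw [gammaLaplace, Real.rpow_sub_one hy.ne']
  field_simp
  ring

theorem add_div_le_two_mul_sq_of_gammaLaplace_le {τ T : ℝ} (hT : 0 < T)
    (h : ∀ᶠ s in 𝓝[>] 0, 4 * gammaLaplace p (τ * T) (T ^ 2 - s ^ 2) ≤
      2 * gammaLaplace p (τ / 2) T ^ 2 + gammaLaplace p (τ / 2) (T + s) ^ 2 +
        gammaLaplace p (τ / 2) (T - s) ^ 2) :
    p + τ / T ≤ 2 * (p + τ / (2 * T)) ^ 2 := by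
  set G := gammaLaplace p (τ / 2) T with hG
  have hGpos : 0 < G := gammaLaplace_pos hT
  have hGsq : gammaLaplace p (τ * T) (T ^ 2) = G ^ 2 := by
    rw [sq G, hG, gammaLaplace_mul_gammaLaplace hT hT, sq]
    ring_nf
  have hf : HasDerivAt (fun v => 2 * (gammaLaplace p (τ * T) (T ^ 2 - v) - G ^ 2))
      (2 * ((p / T ^ 2 + τ * T / (T ^ 2) ^ 2) * G ^ 2)) 0 := by
    have hsub : HasDerivAt (fun v => gammaLaplace p (τ * T) (T ^ 2 - v))
        (-(-(p / T ^ 2 + τ * T / (T ^ 2) ^ 2) * G ^ 2)) 0 :=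
      HasDerivAt.comp_const_sub _ 0 (by
        rw [sub_zero, ← hGsq]
        exact hasDerivAt_gammaLaplace (pow_pos hT 2))
    exact ((hsub.sub_const (G ^ 2)).const_mul 2).congr_deriv (by ring)
  have hg : HasDerivAt
      (fun s => gammaLaplace p (τ / 2) (T + s) - gammaLaplace p (τ / 2) (T - s))
      (-2 * ((p / T + τ / 2 / T ^ 2) * G)) 0 :=
    (hasDerivAt_add_sub_sub (hasDerivAt_gammaLaplace hT)).congr_deriv (by ring)
  have hle := le_sq_of_eventually_comp_sq_le_sq hf hg (by rw [sub_zero, hGsq, sub_self, mul_zero])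
    (by rw [add_zero, sub_zero, sub_self]) (by
      filter_upwards [h, Ioo_mem_nhdsGT hT] with s hs hsT
      have hmul : gammaLaplace p (τ / 2) (T + s) * gammaLaplace p (τ / 2) (T - s) =
          gammaLaplace p (τ * T) (T ^ 2 - s ^ 2) := by
        rw [gammaLaplace_mul_gammaLaplace (by linarith [hsT.1]) (by linarith [hsT.2])]
        ring_nf
      rw [sub_sq, mul_assoc 2 (gammaLaplace _ _ _), hmul]
      linarith)
  have hscaled : p + τ / T - 2 * (p + τ / (2 * T)) ^ 2 =
      T ^ 2 / (2 * G ^ 2) * (2 * ((p / T ^ 2 + τ * T / (T ^ 2) ^ 2) * G ^ 2) -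
        (-2 * ((p / T + τ / 2 / T ^ 2) * G)) ^ 2) := by
    field_simp
  rw [← sub_nonpos, hscaled]
  exact mul_nonpos_of_nonneg_of_nonpos (by positivity) (sub_nonpos.mpr hle)

end gammaLaplace

section Necessity

/-- The pairing of `(t, a, b)` with the coordinates of `ξ` in which the cone of positive
semidefinite `2 × 2` matrices is the forward light cone. -/
def PSDCone.lorentzPairing (t a b : ℝ) (ξ : PSDCone 2) : ℝ :=
  t * ξ.1.trace + a * (ξ.1 0 0 - ξ.1 1 1) + b * (2 * ξ.1 0 1)

/-- The point of the cone of positive semidefinite `2 × 2` matrices with light cone coordinates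
`(t, a, b)`. -/
def PSDCone.ofLorentz {t a b : ℝ} (ht : 0 ≤ t) (hab : a ^ 2 + b ^ 2 ≤ t ^ 2) : PSDCone 2 :=
  ⟨!![t + a, b; b, t - a],
    have ha := abs_le_of_sq_le_sq' (le_of_add_le_of_nonneg_left hab (sq_nonneg b)) ht
    posSemidef_fin_two_of_sq_le_mul (by linarith [ha.1]) (by linarith [ha.2])
      (by linear_combination hab)⟩

variable {t a b p : ℝ} {ω : PSDCone 2} {μ : Measure (PSDCone 2)}

theorem PSDCone.trace_ofLorentz_mul (ht : 0 ≤ t) (hab : a ^ 2 + b ^ 2 ≤ t ^ 2) (ξ : PSDCone 2) :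
    ((PSDCone.ofLorentz ht hab).1 * ξ.1).trace = ξ.lorentzPairing t a b := by
  rw [PSDCone.trace_mul_fin_two, PSDCone.lorentzPairing, Matrix.trace_fin_two]
  simp only [PSDCone.ofLorentz, Matrix.of_apply, Matrix.cons_val', Matrix.cons_val_zero,
    Matrix.cons_val_one, Matrix.cons_val_fin_one]
  ring

theorem PSDCone.sq_add_sq_le_trace_sq (ξ : PSDCone 2) :
    (ξ.1 0 0 - ξ.1 1 1) ^ 2 + (2 * ξ.1 0 1) ^ 2 ≤ ξ.1.trace ^ 2 := by
  rw [Matrix.trace_fin_two]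
  linear_combination 4 * ξ.sq_le_mul_fin_two

theorem wishartLaplace_one_ofLorentz (ht : 0 ≤ t) (hab : a ^ 2 + b ^ 2 ≤ t ^ 2) (p : ℝ)
    (ω : PSDCone 2) :
    wishartLaplace p ω 1 (PSDCone.ofLorentz ht hab) = Real.exp (-ω.1.trace) *
      gammaLaplace p (ω.lorentzPairing (1 + t) (-a) (-b)) ((1 + t) ^ 2 - (a ^ 2 + b ^ 2)) := by
  have hD : 0 < (1 + t) ^ 2 - (a ^ 2 + b ^ 2) := by linarith
  have hadd : 1 + (1 : PSDCone 2).1 * (PSDCone.ofLorentz ht hab).1 =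
      !![1 + t + a, b; b, 1 + t - a] := by
    rw [PSDCone.coe_one, one_mul, Matrix.one_fin_two, PSDCone.ofLorentz]
    simp [add_assoc, add_sub_assoc]
  have hdet : (!![1 + t + a, b; b, 1 + t - a] : Matrix (Fin 2) (Fin 2) ℝ).det =
      (1 + t) ^ 2 - (a ^ 2 + b ^ 2) := by
    rw [Matrix.det_fin_two_of]
    ring
  have hriccati : (PSDCone.riccati 1 (PSDCone.ofLorentz ht hab)).1 =
      ((1 + t) ^ 2 - (a ^ 2 + b ^ 2))⁻¹ •
        !![(t + a) * (1 + t - a) - b ^ 2, b; b, (t - a) * (1 + t + a) - b ^ 2] := by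
    rw [PSDCone.coe_riccati, hadd, Matrix.inv_def, hdet, Ring.inverse_eq_inv', mul_smul_comm,
      Matrix.adjugate_fin_two_of, PSDCone.ofLorentz, Matrix.mul_fin_two]
    ring_nf
  have htrace := PSDCone.trace_mul_fin_two (PSDCone.riccati 1 (PSDCone.ofLorentz ht hab)) ω
  rw [wishartLaplace_eq_riccati, htrace, hriccati, hadd, hdet, gammaLaplace, mul_left_comm,
    ← Real.exp_add, PSDCone.lorentzPairing, Matrix.trace_fin_two]
  congr 2
  simp only [Matrix.smul_apply, Matrix.of_apply, Matrix.cons_val', Matrix.cons_val_zero,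
    Matrix.cons_val_one, Matrix.cons_val_fin_one, smul_eq_mul]
  field_simp
  ring

theorem IsNoncentralWishart.integrable_exp_neg_lorentzPairing (h : IsNoncentralWishart p ω 1 μ)
    (ht : 0 ≤ t) (hab : a ^ 2 + b ^ 2 ≤ t ^ 2) :
    Integrable (fun ξ : PSDCone 2 => Real.exp (-ξ.lorentzPairing t a b)) μ := by
  simpa only [PSDCone.trace_ofLorentz_mul] using h.integrable (PSDCone.ofLorentz ht hab)

theorem IsNoncentralWishart.integral_exp_neg_lorentzPairing (h : IsNoncentralWishart p ω 1 μ)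
    (ht : 0 ≤ t) (hab : a ^ 2 + b ^ 2 ≤ t ^ 2) :
    ∫ ξ : PSDCone 2, Real.exp (-ξ.lorentzPairing t a b) ∂μ = Real.exp (-ω.1.trace) *
      gammaLaplace p (ω.lorentzPairing (1 + t) (-a) (-b)) ((1 + t) ^ 2 - (a ^ 2 + b ^ 2)) := by
  rw [← wishartLaplace_one_ofLorentz ht hab, ← h.laplaceTransform_eq, laplaceTransform]
  simp only [PSDCone.trace_ofLorentz_mul]

theorem IsNoncentralWishart.integral_exp_neg_lorentzPairing_zero_zero
    (h : IsNoncentralWishart p ω 1 μ) (ht : 0 ≤ t) :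
    ∫ ξ : PSDCone 2, Real.exp (-ξ.lorentzPairing t 0 0) ∂μ =
      Real.exp (-ω.1.trace) * gammaLaplace p (ω.1.trace / 2) (1 + t) ^ 2 := by
  have hT : 0 < 1 + t := by positivity
  rw [h.integral_exp_neg_lorentzPairing ht (by nlinarith), sq (gammaLaplace _ _ _),
    gammaLaplace_mul_gammaLaplace hT hT, PSDCone.lorentzPairing]
  ring_nf

theorem IsNoncentralWishart.two_mul_gammaLaplace_le_integral (h : IsNoncentralWishart p ω 1 μ)
    (ht : 0 ≤ t) (hab : a ^ 2 + b ^ 2 ≤ t ^ 2) :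
    Real.exp (-ω.1.trace) *
        (2 * gammaLaplace p (ω.1.trace * (1 + t)) ((1 + t) ^ 2 - (a ^ 2 + b ^ 2))) ≤
      ∫ ξ : PSDCone 2, (Real.exp (-ξ.lorentzPairing t a b) +
        Real.exp (-ξ.lorentzPairing t (-a) (-b))) ∂μ := by
  have hab' : (-a) ^ 2 + (-b) ^ 2 ≤ t ^ 2 := by rwa [neg_sq, neg_sq]
  rw [integral_add (h.integrable_exp_neg_lorentzPairing ht hab)
    (h.integrable_exp_neg_lorentzPairing ht hab'), h.integral_exp_neg_lorentzPairing ht hab,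
    h.integral_exp_neg_lorentzPairing ht hab', neg_sq, neg_sq, ← mul_add]
  refine mul_le_mul_of_nonneg_left ?_ (Real.exp_nonneg _)
  set e := a * (ω.1 0 0 - ω.1 1 1) + b * (2 * ω.1 0 1) with he
  have hneg : ω.lorentzPairing (1 + t) (-a) (-b) = ω.1.trace * (1 + t) - e := by
    rw [PSDCone.lorentzPairing, he]
    ring
  have hpos : ω.lorentzPairing (1 + t) (- -a) (- -b) = ω.1.trace * (1 + t) + e := by
    rw [PSDCone.lorentzPairing, he]
    ring
  rw [hneg, hpos]
  exact two_mul_gammaLaplace_le (by linarith) e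

theorem PSDCone.exp_neg_lorentzPairing_add_le (t s : ℝ) (ξ : PSDCone 2) :
    Real.exp (-ξ.lorentzPairing t s 0) + Real.exp (-ξ.lorentzPairing t (-s) 0) +
        (Real.exp (-ξ.lorentzPairing t 0 s) + Real.exp (-ξ.lorentzPairing t 0 (-s))) ≤
      2 * Real.exp (-ξ.lorentzPairing t 0 0) + Real.exp (-ξ.lorentzPairing (t + s) 0 0) +
        Real.exp (-ξ.lorentzPairing (t - s) 0 0) := by
  have hcosh := cosh_add_cosh_le (x := s * (ξ.1 0 0 - ξ.1 1 1)) (y := s * (2 * ξ.1 0 1))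
    (z := s * ξ.1.trace) (by
      linear_combination s ^ 2 * ξ.sq_add_sq_le_trace_sq)
  have hexp := mul_le_mul_of_nonneg_left hcosh (Real.exp_nonneg (-(t * ξ.1.trace)))
  simp only [Real.cosh_eq, PSDCone.lorentzPairing, zero_mul, add_zero, neg_mul, neg_add, neg_neg,
    add_mul, sub_eq_add_neg, Real.exp_add] at hexp ⊢
  linarith

theorem IsNoncentralWishart.four_mul_gammaLaplace_le {s : ℝ} (h : IsNoncentralWishart p ω 1 μ)
    (hs : 0 ≤ s) (hst : s ≤ t) :
    4 * gammaLaplace p (ω.1.trace * (1 + t)) ((1 + t) ^ 2 - s ^ 2) ≤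
      2 * gammaLaplace p (ω.1.trace / 2) (1 + t) ^ 2 +
        gammaLaplace p (ω.1.trace / 2) (1 + t + s) ^ 2 +
          gammaLaplace p (ω.1.trace / 2) (1 + t - s) ^ 2 := by
  have ht : 0 ≤ t := hs.trans hst
  have hint {r a b : ℝ} (hr : 0 ≤ r) (hab : a ^ 2 + b ^ 2 ≤ r ^ 2) :=
    h.integrable_exp_neg_lorentzPairing hr hab
  have hsq : s ^ 2 ≤ t ^ 2 := pow_le_pow_left₀ hs hst 2
  have h₁ : s ^ 2 + 0 ^ 2 ≤ t ^ 2 := by linarith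
  have h₁' : (-s) ^ 2 + 0 ^ 2 ≤ t ^ 2 := by linarith
  have h₂ : 0 ^ 2 + s ^ 2 ≤ t ^ 2 := by linarith
  have h₂' : 0 ^ 2 + (-s) ^ 2 ≤ t ^ 2 := by linarith
  have h₀ (r : ℝ) : (0 : ℝ) ^ 2 + 0 ^ 2 ≤ r ^ 2 := by nlinarith
  have hleft₁ := (hint ht h₁).add (hint ht h₁')
  have hleft₂ := (hint ht h₂).add (hint ht h₂')
  have hright₀ := (hint ht (h₀ t)).const_mul 2
  have hright₁ := hint (add_nonneg ht hs) (h₀ _)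
  have hright₂ := hint (sub_nonneg.mpr hst) (h₀ _)
  have hmono := integral_mono (hleft₁.add hleft₂) ((hright₀.add hright₁).add hright₂)
    (PSDCone.exp_neg_lorentzPairing_add_le t s)
  rw [integral_add' hleft₁ hleft₂, integral_add' (hright₀.add hright₁) hright₂,
    integral_add' hright₀ hright₁, integral_const_mul,
    h.integral_exp_neg_lorentzPairing_zero_zero ht,
    h.integral_exp_neg_lorentzPairing_zero_zero (add_nonneg ht hs),
    h.integral_exp_neg_lorentzPairing_zero_zero (sub_nonneg.mpr hst)] at hmono
  have hpair₁ := h.two_mul_gammaLaplace_le_integral ht h₁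
  have hpair₂ := h.two_mul_gammaLaplace_le_integral ht h₂
  rw [neg_zero] at hpair₁ hpair₂
  have hle := (add_le_add hpair₁ hpair₂).trans hmono
  refine le_of_mul_le_mul_left ?_ (Real.exp_pos (-ω.1.trace))
  convert hle using 1
  · ring_nf
  · ring_nf

theorem half_le_of_forall_add_div_le {τ : ℝ} (hp : 0 ≤ p) (hτ : 0 ≤ τ)
    (h : ∀ T, 1 < T → p + τ / T ≤ 2 * (p + τ / (2 * T)) ^ 2) (hpτ : p = 0 → τ ≠ 0) :
    1 / 2 ≤ p := by
  rcases hp.eq_or_lt with rfl | hp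
  · have hτ : 0 < τ := hτ.lt_of_ne' (hpτ rfl)
    have hle := h (1 + τ) (by linarith)
    have heq : 2 * (0 + τ / (2 * (1 + τ))) ^ 2 = τ / (1 + τ) * (τ / (2 * (1 + τ))) := by
      field_simp
      ring
    have hlt : τ / (2 * (1 + τ)) < 1 := (div_lt_one (by linarith)).mpr (by linarith)
    rw [heq, zero_add] at hle
    exact absurd hle (mul_lt_of_lt_one_right (by positivity) hlt).not_ge
  · have hdiv {c : ℝ} (hc : 0 < c) : Tendsto (fun T => p + τ / (c * T)) atTop (𝓝 (p + 0)) :=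
      tendsto_const_nhds.add (tendsto_const_nhds.div_atTop (tendsto_id.const_mul_atTop hc))
    have hlim : p + 0 ≤ 2 * (p + 0) ^ 2 := by
      refine le_of_tendsto_of_tendsto (hdiv one_pos) (((hdiv two_pos).pow 2).const_mul 2) ?_
      filter_upwards [eventually_gt_atTop 1] with T hT
      simpa only [one_mul] using h T hT
    nlinarith

theorem IsNoncentralWishart.half_le (h : IsNoncentralWishart p ω 1 μ)
    (hμ : μ ≠ Measure.dirac 0) : 1 / 2 ≤ p := by
  refine half_le_of_forall_add_div_le (h.nonneg one_le_two) ω.2.trace_nonneg (fun T hT => ?_) ?_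
  · refine add_div_le_two_mul_sq_of_gammaLaplace_le (one_pos.trans hT) ?_
    filter_upwards [Ioo_mem_nhdsGT (sub_pos.mpr hT)] with s hs
    simpa only [add_sub_cancel] using h.four_mul_gammaLaplace_le hs.1.le hs.2.le
  · rintro rfl hτ
    obtain rfl : ω = 0 := Subtype.ext (ω.2.trace_eq_zero_iff.mp hτ)
    exact hμ h.eq_dirac_zero

end Necessity

theorem corollary3_general (d : ℕ) (hd1 : 1 ≤ d) (hd2 : d ≤ 2) (p : ℝ)
    (ω σ : PSDCone d) (hσ : IsUnit σ.1)
    (hpω : d = 1 → p = 0 → ω ≠ 0) :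
    (∃ μ : Measure (PSDCone d), IsNoncentralWishart p ω σ μ ∧ μ ≠ Measure.dirac 0) ↔
      p ∈ gindikinEnsemble d := by
  obtain ⟨g, rfl⟩ := PSDCone.exists_smul_one_eq hσ
  obtain ⟨η, rfl⟩ : ∃ η, g • η = ω := ⟨g⁻¹ • ω, smul_inv_smul g ω⟩
  rw [exists_isNoncentralWishart_smul_iff]
  interval_cases d
  · rw [gindikinEnsemble_one, Set.mem_Ici]
    refine ⟨fun ⟨μ, hμ, _⟩ => hμ.nonneg le_rfl, fun hp => ?_⟩
    obtain ⟨w, rfl⟩ := η.exists_scalar_eq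
    have hμ := isNoncentralWishart_map_scalar_noncentralGamma hp w
    exact ⟨_, hμ, hμ.ne_dirac_zero le_rfl hp fun h0 hw =>
      hpω rfl h0 (by rw [hw, Units.smul_def, smul_zero])⟩
  · rw [gindikinEnsemble_two, Set.mem_Ici]
    refine ⟨fun ⟨μ, hμ, hne⟩ => hμ.half_le hne, fun hp => ?_⟩
    obtain ⟨μ, hμ⟩ := exists_isNoncentralWishart_one_fin_two hp η
    exact ⟨μ, hμ, hμ.ne_dirac_zero one_le_two (by linarith) fun h0 => by linarith⟩

theorem corollary3 (d : ℕ) (hd1 : 1 ≤ d) (hd2 : d ≤ 2) (p : ℝ) (hp : 0 ≤ p)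
    (ω σ : PSDCone d) (hσ : IsUnit σ.1)
    (hpω : d = 1 → p = 0 → ω ≠ 0) :
    (∃ μ : Measure (PSDCone d), IsNoncentralWishart p ω σ μ ∧ μ ≠ Measure.dirac 0) ↔
      p ∈ gindikinEnsemble d :=
  corollary3_general d hd1 hd2 p ω σ hσ hpω
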